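/- For a represented space $\mathbf X=(X,\delta_X)$, where $\delta_X:\subseteq\mathbb N^{\mathbb N}\to X$ is a partial surjection, let $\mathcal A(\mathbf X)$ be the represented space of all subsets of $X$ that are closed in the final topology of $\delta_X$, given by negative information (a name of $A$ is a name of the characteristic function of $X\setminus A$ as a continuous function from $\mathbf X$ into Sierpiński space). Closed choice is the multi-valued function $\mathsf C_{\mathbf X}:\subseteq\mathcal A(\mathbf X)\rightrightarrows\mathbf X$, $A\mapsto A$, with $\operatorname{dom}(\mathsf C_{\mathbf X})=\{A: A\neq\emptyset\}$. Let $\frac12\mathsf C_{[0,1]}:\subseteq\mathcal A([0,1])\rightrightarrows[0,1]\times[0,1]$ map every nonempty closed $A\subseteq[0,1]$ to the set of all pairs $(x_0,x_1)\in[0,1]^2$ with $x_0\in A$ or $x_1\in A$. Here $\{0,1\}$ carries the discrete representation $p\mapsto p(0)$ and $[0,1]$ carries the representation by rapidly converging sequences of rationals. For represented spaces $\mathbf Y,\mathbf V$ let $\mathcal M(\mathbf Y,\mathbf V)$ be the represented space of strongly continuous multi-valued functions $H:\subseteq\mathbf Y\rightrightarrows\mathbf V$: a name of $H$ is a $p\in\mathbb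 N^{\mathbb N}$ with $H=\delta_V\circ\Phi_p\circ(\delta_Y^{\mathrm{cyl}})^{-1}$, where $\delta_Y^{\mathrm{cyl}}\langle q,r\rangle=\delta_Y(q)$ and $\Phi$ is a universal function for the partial continuous functions on $\mathbb N^{\mathbb N}$ ($\Phi_p(q)$ is the infinite output of a universal Turing machine on input $\langle p,q\rangle$). The composition of multi-valued functions is defined by: $x\in\operatorname{dom}(H\circ g)$ if and only if $x\in\operatorname{dom}(g)$ and $g(x)\subseteq\operatorname{dom}(H)$, and then $(H\circ g)(x)=\bigcup_{y\in g(x)}H(y)$. For $g:\subseteq\mathbf X\rightrightarrows\mathbf Y$ and $f:\subseteq\mathbf U\rightrightarrows\mathbf V$ with $\operatorname{dom}(g)\neq\emptyset$ or $\operatorname{dom}(f)=\emptyset$, the implication $(g\to f):\subseteq\mathbf U\rightrightarrows\mathcal M(\mathbf Y,\mathbf V)\times\mathbf X$ has $\operatorname{dom}(g\to f)=\operatorname{dom}(f)$ and maps $u\in\operatorname{dom}(f)$ to the set of all pairs $(H,x)$ with $x\in\operatorname{dom}(H\circ g)$ and $(H\circ g)(x)\subseteq f(u)$. A realizer of a multi-valued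 function $f$ is a partial function $F:\subseteq\mathbb N^{\mathbb N}\to\mathbb N^{\mathbb N}$ that maps every name of every $x\in\operatorname{dom}(f)$ to a name of some element of $f(x)$. One writes $f\leq_{\mathrm W}g$ if there are computable $K,H:\subseteq\mathbb N^{\mathbb N}\to\mathbb N^{\mathbb N}$ such that $K\langle\mathrm{id},GH\rangle$ is a realizer of $f$ for every realizer $G$ of $g$, and $f\equiv_{\mathrm W}g$ if $f\leq_{\mathrm W}g$ and $g\leq_{\mathrm W}f$. Then $$\tfrac12\mathsf C_{[0,1]}\equiv_{\mathrm W}(\mathsf C_{\{0,1\}}\to\mathsf C_{[0,1]}).$$ -/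

import Mathlib

namespace Weihrauch

/-! ### Baire space and its partial computable functions -/

/-- Baire space `ℕ^ℕ`; its topology is the product topology of discrete spaces. -/
abbrev Baire : Type := ℕ → ℕ

/-- The pairing of Baire space by interleaving: `p` on the even positions, `q` on the odd ones. -/
def pair (p q : Baire) : Baire := fun n => if n % 2 = 0 then p (n / 2) else q (n / 2)

theorem pair_even (p q : Baire) (n : ℕ) : pair p q (2 * n) = p n := by
  simp [pair]

theorem pair_odd (p q : Baire) (n : ℕ) : pair p q (2 * n + 1) = q n := by
  have h1 : (2 * n + 1) % 2 = 1 := by omega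
  have h2 : (2 * n + 1) / 2 = n := by omega
  simp [pair, h1, h2]

theorem pair_inj {p q p' q' : Baire} (h : pair p q = pair p' q') : p = p' ∧ q = q' := by
  constructor
  · funext n
    rw [← pair_even p q n, h, pair_even]
  · funext n
    rw [← pair_odd p q n, h, pair_odd]

/-- The finite word `q 0, …, q (m - 1)`. -/
def prefixWord (q : Baire) (m : ℕ) : List ℕ := (List.range m).map q

/-- The number of the question "what is the `n`-th output symbol, when `w` is the part of the
input that has been read so far?". -/
def query (n : ℕ) (w : List ℕ) : ℕ := Nat.pair n (Encodable.encode w)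

/-- The universal function `Φ` of Baire space (application in Kleene's second algebra).  Longer and
longer prefixes of the input `q` are read; the entry of `p` at a query is `0` if more input is
needed, and it is `v + 1` if the `n`-th output symbol is `v`.  The input `q` belongs to the domain
of `Φ p` if and only if all (infinitely many) output symbols are produced in this way.
The functions `Φ p` are exactly the partial continuous functions with a domain of type `G_δ`, and
those with a computable `p` are exactly the functions that are computed by Type-2 machines. -/
def Φ (p : Baire) : Baire →. Baire := fun q =>
  ⟨∀ n, ∃ m, p (query n (prefixWord q m)) ≠ 0,
   fun h n => p (query n (prefixWord q (Nat.find (h n)))) - 1⟩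

/-- A partial function on Baire space is computable if it is a restriction of some `Φ p` with `p`
computable. -/
def ComputableFun (F : Baire →. Baire) : Prop :=
  ∃ p : Baire, Computable p ∧ ∀ q r, r ∈ F q → r ∈ Φ p q

/-! ### Represented spaces -/

/-- A representation of `X`, that is, a partial surjection from Baire space onto `X`, given by its
graph: `Names p x` says that `p` is in the domain of the representation and is mapped to `x`. -/
class Represented (X : Type*) where
  Names : Baire → X → Prop
  functional : ∀ {p x y}, Names p x → Names p y → x = y
  surjective : ∀ x, ∃ p, Names p x

/-- The final topology of the representation. -/
@[reducible] noncomputable def finalTopology (X : Type*) [Represented X] : TopologicalSpace X :=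
  TopologicalSpace.coinduced
    (fun p : {p : Baire // ∃ x : X, Represented.Names p x} => p.2.choose) inferInstance

/-- The product of two represented spaces. -/
instance instProd (X Y : Type*) [Represented X] [Represented Y] : Represented (X × Y) where
  Names p z := ∃ q r, p = pair q r ∧ Represented.Names q z.1 ∧ Represented.Names r z.2
  functional := by
    rintro p x y ⟨q, r, rfl, h1, h2⟩ ⟨q', r', h, h1', h2'⟩
    obtain ⟨rfl, rfl⟩ := pair_inj h
    exact Prod.ext (Represented.functional h1 h1') (Represented.functional h2 h2')
  surjective := by
    rintro ⟨x, y⟩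
    obtain ⟨q, hq⟩ := Represented.surjective x
    obtain ⟨r, hr⟩ := Represented.surjective y
    exact ⟨pair q r, q, r, rfl, hq, hr⟩

/-- The two-point space `{0, 1}`: a name of `i` is a sequence with first entry `i`. -/
instance instTwo : Represented (Fin 2) where
  Names p i := p 0 = i
  functional := by
    intro p x y hx hy
    exact Fin.ext (hx.symm.trans hy)
  surjective i := ⟨fun _ => i, rfl⟩

/-- A numbering of the rational numbers: `⟨a, ⟨b, c⟩⟩ ↦ (a - b) / (c + 1)`. -/
def ratOfNat (n : ℕ) : ℚ :=
  ((n.unpair.1 : ℚ) - (n.unpair.2.unpair.1 : ℚ)) / ((n.unpair.2.unpair.2 : ℚ) + 1)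

theorem ratOfNat_surjective : Function.Surjective ratOfNat := by
  intro q
  refine ⟨Nat.pair q.num.toNat (Nat.pair (-q.num).toNat (q.den - 1)), ?_⟩
  have h1 : ((q.num.toNat : ℚ) - ((-q.num).toNat : ℚ)) = (q.num : ℚ) := by
    have h : ((q.num.toNat : ℤ) - ((-q.num).toNat : ℤ)) = q.num := by omega
    exact_mod_cast h
  have h2 : (((q.den - 1 : ℕ) : ℚ) + 1) = (q.den : ℚ) := by
    have h := q.pos
    have h' : q.den - 1 + 1 = q.den := by omega
    exact_mod_cast h'
  simp only [ratOfNat, Nat.unpair_pair, h1, h2]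
  exact Rat.num_div_den q

/-- The unit interval: a name of `x` is a sequence of (numbers of) rationals converging rapidly to
`x`, the `i`-th one having distance at most `2 ^ (-i)` to `x`. -/
instance instUnitInterval : Represented unitInterval where
  Names p x := ∀ i : ℕ, |(ratOfNat (p i) : ℝ) - (x : ℝ)| ≤ (1 / 2 : ℝ) ^ i
  functional := by
    intro p x y hx hy
    have hlim : Filter.Tendsto (fun i : ℕ => (1 / 2 : ℝ) ^ i) Filter.atTop (nhds 0) :=
      tendsto_pow_atTop_nhds_zero_of_lt_one (by norm_num) (by norm_num)
    have key : ∀ z : unitInterval, (∀ i : ℕ, |(ratOfNat (p i) : ℝ) - (z : ℝ)| ≤ (1 / 2 : ℝ) ^ i) →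
        Filter.Tendsto (fun i : ℕ => (ratOfNat (p i) : ℝ)) Filter.atTop (nhds (z : ℝ)) := by
      intro z hz
      rw [tendsto_iff_dist_tendsto_zero]
      exact squeeze_zero (fun _ => dist_nonneg) (fun i => by rw [Real.dist_eq]; exact hz i) hlim
    exact Subtype.ext (tendsto_nhds_unique (key x hx) (key y hy))
  surjective := by
    intro x
    have h : ∀ i : ℕ, ∃ n : ℕ, |(ratOfNat n : ℝ) - (x : ℝ)| ≤ (1 / 2 : ℝ) ^ i := by
      intro i
      obtain ⟨q, hq1, hq2⟩ := exists_rat_btwn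
        (show (x : ℝ) < (x : ℝ) + (1 / 2 : ℝ) ^ i from lt_add_of_pos_right _ (by positivity))
      obtain ⟨n, rfl⟩ := ratOfNat_surjective q
      refine ⟨n, ?_⟩
      rw [abs_le]
      constructor
      · have : (0 : ℝ) < (1 / 2 : ℝ) ^ i := by positivity
        linarith
      · linarith
    choose p hp using h
    exact ⟨p, hp⟩

/-! ### The space of closed subsets with negative information -/

/-- The underlying set of `𝒜(X)`: the subsets of `X` that are closed in the final topology. -/
def ClosedSubset (X : Type*) [Represented X] : Type _ := {A : Set X // @IsClosed X (finalTopology X) A}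

/-- `p` is a negative name of `A`: `Φ p` realizes the characteristic function of the complement of
`A` as a function into Sierpiński space, in which `⊥` is represented by the zero sequence only and
`⊤` by all other sequences. -/
def NegativeName {X : Type*} [Represented X] (p : Baire) (A : Set X) : Prop :=
  ∀ q x, Represented.Names q x → ∃ r ∈ Φ p q, (r = 0 ↔ x ∈ A)

theorem NegativeName.unique {X : Type*} [Represented X] {p : Baire} {A B : Set X}
    (hA : NegativeName p A) (hB : NegativeName p B) : A = B := by
  ext x
  obtain ⟨q, hq⟩ := Represented.surjective x
  obtain ⟨r, hr, h⟩ := hA q x hq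
  obtain ⟨s, hs, h'⟩ := hB q x hq
  obtain rfl := Part.mem_unique hr hs
  exact h.symm.trans h'

theorem NegativeName.exists_of_isClosed {X : Type*} [Represented X] {A : Set X}
    (hA : @IsClosed X (finalTopology X) A) : ∃ p, NegativeName p A := by
  classical
  have hO : @IsOpen X (finalTopology X) Aᶜ := (@isOpen_compl_iff X A (finalTopology X)).2 hA
  obtain ⟨O, hO, hOA⟩ := isOpen_induced_iff.1 (isOpen_coinduced.1 hO)
  have hmem : ∀ q x, Represented.Names q x → (q ∈ O ↔ x ∉ A) := by
    intro q x hq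
    have hex : ∃ y : X, Represented.Names q y := ⟨x, hq⟩
    have h := Set.ext_iff.1 hOA ⟨q, hex⟩
    have hx : hex.choose = x := Represented.functional hex.choose_spec hq
    simpa [hx] using h
  let C : List ℕ → Prop := fun w =>
    ∀ q (x : X), Represented.Names q x → prefixWord q w.length = w → x ∉ A
  let P : ℕ → List ℕ → ℕ := fun n w => if w.length < n then 0 else if C w then 2 else 1
  have hlen : ∀ q m, (prefixWord q m).length = m := by intro q m; simp [prefixWord]
  let p : Baire := fun k => P k.unpair.1 ((Encodable.decode k.unpair.2).getD [])
  have hp : ∀ n w, p (query n w) = P n w := by intro n w; simp [p, query]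
  have hP : ∀ q n m, P n (prefixWord q m) =
      if m < n then 0 else if C (prefixWord q m) then 2 else 1 := by
    intro q n m; simp [P, hlen]
  refine ⟨p, fun q x hq => ?_⟩
  have htot : ∀ n, ∃ m, p (query n (prefixWord q m)) ≠ 0 := by
    intro n
    refine ⟨n, ?_⟩
    rw [hp, hP, if_neg (lt_irrefl n)]
    split_ifs <;> norm_num
  refine ⟨(Φ p q).get htot, Part.get_mem htot, ?_⟩
  have hval : ∀ n, ∃ m, n ≤ m ∧
      (Φ p q).get htot n = if C (prefixWord q m) then 1 else 0 := by
    intro n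
    have hspec := Nat.find_spec (htot n)
    have hget : (Φ p q).get htot n = p (query n (prefixWord q (Nat.find (htot n)))) - 1 := rfl
    rw [hp, hP] at hspec hget
    refine ⟨Nat.find (htot n), ?_, ?_⟩
    · by_contra hlt
      exact hspec (if_pos (not_le.1 hlt))
    · have hlt : ¬ Nat.find (htot n) < n := fun hlt => hspec (if_pos hlt)
      rw [hget, if_neg hlt]
      split_ifs <;> rfl
  constructor
  · intro h0
    by_contra hx
    obtain ⟨n, hn⟩ : ∃ n, PiNat.cylinder q n ⊆ O := by
      obtain ⟨v, ⟨y, n, rfl⟩, hqv, hvO⟩ :=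
        (PiNat.isTopologicalBasis_cylinders (fun _ : ℕ => ℕ)).exists_subset_of_mem_open
          ((hmem q x hq).2 hx) hO
      exact ⟨n, by rwa [← PiNat.mem_cylinder_iff_eq.1 hqv] at hvO⟩
    obtain ⟨m, hnm, hm⟩ := hval n
    have hC : C (prefixWord q m) := by
      intro q' x' hq' hpre
      refine (hmem q' x' hq').1 (hn ?_)
      intro i hi
      rw [hlen] at hpre
      have h := congrArg (fun l : List ℕ => l[i]?) hpre
      have hi' : i < m := lt_of_lt_of_le hi hnm
      simpa [prefixWord, hi'] using h
    rw [if_pos hC, h0] at hm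
    exact absurd hm (by norm_num)
  · intro hx
    funext n
    obtain ⟨m, -, hm⟩ := hval n
    rw [hm]
    have hC : ¬ C (prefixWord q m) := fun hC => hC q x hq (by rw [hlen]) hx
    rw [if_neg hC]
    rfl

/-- The represented space `𝒜(X)`. -/
instance instClosedSubset (X : Type*) [Represented X] : Represented (ClosedSubset X) where
  Names p A := NegativeName p A.1
  functional hA hB := Subtype.ext (hA.unique hB)
  surjective A := NegativeName.exists_of_isClosed A.2

/-! ### Multi-valued functions -/

/-- A partial multi-valued function `f : ⊆ X ⇉ Y`, given by its graph: `f x` is the set of the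
possible values at `x`. -/
abbrev Multifun (X Y : Type*) : Type _ := X → Set Y

/-- The domain of a multi-valued function. -/
def Multifun.dom {X Y : Type*} (f : Multifun X Y) : Set X := {x | (f x).Nonempty}

/-- The composition of multi-valued functions: `x` belongs to its domain only if all of `g x` is
contained in the domain of `f`. -/
def Multifun.comp {X Y Z : Type*} (f : Multifun Y Z) (g : Multifun X Y) : Multifun X Z :=
  fun x => {z | g x ⊆ f.dom ∧ ∃ y ∈ g x, z ∈ f y}

/-- `F` is a realizer of `f`. -/
def Realizes {X Y : Type*} [Represented X] [Represented Y] (F : Baire →. Baire)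
    (f : Multifun X Y) : Prop :=
  ∀ p x, Represented.Names p x → x ∈ f.dom → ∃ r ∈ F p, ∃ y ∈ f x, Represented.Names r y

/-- Weihrauch reducibility `f ≤_W g`: there are computable `K` and `H` such that `K⟨id, GH⟩`
realizes `f` for every realizer `G` of `g`. -/
def Reducible {X Y U V : Type*} [Represented X] [Represented Y] [Represented U] [Represented V]
    (f : Multifun X Y) (g : Multifun U V) : Prop :=
  ∃ K H : Baire →. Baire, ComputableFun K ∧ ComputableFun H ∧
    ∀ G : Baire →. Baire, Realizes G g →
      Realizes (fun p => (H p).bind fun q => (G q).bind fun r => K (pair p r)) f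

/-- Weihrauch equivalence `f ≡_W g`. -/
def Equivalent {X Y U V : Type*} [Represented X] [Represented Y] [Represented U] [Represented V]
    (f : Multifun X Y) (g : Multifun U V) : Prop :=
  Reducible f g ∧ Reducible g f

/-! ### Strongly continuous multi-valued functions and the implication -/

/-- The multi-valued function `δ_Y ∘ Φ p ∘ (δ_X^cyl)⁻¹`, where the cylindrification `δ_X^cyl` maps
`⟨q, r⟩` to `δ_X q`, so that `x` has the names `⟨q, r⟩` with `q` a `δ_X`-name of `x` and `r`
arbitrary. -/
def strongFun (X Y : Type*) [Represented X] [Represented Y] (p : Baire) : Multifun X Y := fun x =>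
  {y | (∀ q r, Represented.Names q x → ∃ s ∈ Φ p (pair q r), ∃ z : Y, Represented.Names s z) ∧
    ∃ q r, Represented.Names q x ∧ ∃ s ∈ Φ p (pair q r), Represented.Names s y}

/-- The underlying set of `ℳ(X, Y)`: the strongly continuous multi-valued functions. -/
def StrongMultifun (X Y : Type*) [Represented X] [Represented Y] : Type _ :=
  {f : Multifun X Y // ∃ p, f = strongFun X Y p}

/-- The represented space `ℳ(X, Y)`. -/
instance instStrongMultifun (X Y : Type*) [Represented X] [Represented Y] :
    Represented (StrongMultifun X Y) where
  Names p f := f.1 = strongFun X Y p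
  functional hf hg := Subtype.ext (hf.trans hg.symm)
  surjective f := f.2

/-- The implication `(g → f)`.  Its values at `u` are the pairs `(H, x)` such that `x` belongs to
the domain of `H ∘ g` and `(H ∘ g)(x) ⊆ f u`; hence its domain is that of `f`.  It is a multi-valued function only if `g` is
somewhere defined or `f` is nowhere defined (otherwise it is the top degree). -/
def implication {X Y U V : Type*} [Represented X] [Represented Y] [Represented U] [Represented V]
    (g : Multifun X Y) (f : Multifun U V) (_h : g.dom.Nonempty ∨ f.dom = ∅) :
    Multifun U (StrongMultifun Y V × X) := fun u =>
  {Hx | Hx.2 ∈ (Multifun.comp Hx.1.1 g).dom ∧ Multifun.comp Hx.1.1 g Hx.2 ⊆ f u}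

/-! ### Choice problems -/

/-- Closed choice `C_X`: given a nonempty closed set, find a point of it. -/
def closedChoice (X : Type*) [Represented X] : Multifun (ClosedSubset X) X := fun A => A.1

/-- The problem `½C_X`: given a nonempty closed set, find two points of `X` at least one of which
belongs to the set. -/
def halfClosedChoice (X : Type*) [Represented X] : Multifun (ClosedSubset X) (X × X) := fun A =>
  {z | z.1 ∈ A.1 ∨ z.2 ∈ A.1}

theorem closedChoice_dom_nonempty (X : Type*) [Represented X] [Nonempty X] :
    (closedChoice X).dom.Nonempty :=
  ⟨⟨Set.univ, @isClosed_univ X (finalTopology X)⟩, Set.univ_nonempty⟩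

end Weihrauch

namespace Weihrauch

/-! ### Uniformly computable functions with an oracle -/

/-! Two guesses x₀, x₁ for a point of A amount to a function H on {0, 1}, together with the set B of
those indices at which the guess is right. From guesses to the implication
(`implication_reducible_half`, over any represented space): put H(i) = {xᵢ} and B = {i | xᵢ ∈ A}.
One guess is right, so B is nonempty. Feeding a name of xᵢ to the negative name of A gives negative
information on B, and H maps every choice from B into A. Names of H and B arise from those of A, x₀
and x₁ by re-indexing. Conversely (`half_reducible_implication`), given (H, B), evaluate H at one
fixed name of 0 and one of 1. For i ∈ B this produces a name of a point of A. For i ∉ B the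
evaluation may diverge or produce rubbish, but then the negative information on B eventually
excludes i. So each symbol is computed in parallel with the exclusion test, and once i is excluded
any symbol will do (`exists_stage`, `symbol_eq`). The resulting sequence need not be a name. On [0,
1] it can be repaired: clamping the entries and skipping long jumps turns every sequence into a
name, and keeps the point of a genuine name (`exists_repair_names`, `repair_names`). Computability
is handled by `ComputableOn`, which is closed under composition, recursion and successful search,
and which yields computable names for `Φ` by `ComputableOn.computableFun`. -/

theorem prefixWord_prefix (q : Baire) {m m' : ℕ} (h : m ≤ m') :
    prefixWord q m <+: prefixWord q m' := by
  obtain ⟨k, rfl⟩ := Nat.exists_eq_add_of_le h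
  rw [prefixWord, prefixWord, List.range_add, List.map_append]
  exact List.prefix_append _ _

theorem length_prefixWord (q : Baire) (m : ℕ) : (prefixWord q m).length = m := by
  simp [prefixWord]

section

variable {α β γ : Type} [Primcodable α] [Primcodable β] [Primcodable γ]

/-- `F q a` is computable from `a` with the oracle `q`, uniformly in `q ∈ S`: there is a computable
function that maps `a` and a sufficiently long prefix of `q` to `F q a`, and that reports when the
prefix is too short. -/
def ComputableOn (S : Set Baire) (F : Baire → α → β) : Prop :=
  ∃ f : α → List ℕ → Option β, Computable₂ f ∧
    (∀ a w w' b, w <+: w' → f a w = some b → f a w' = some b) ∧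
    ∀ q ∈ S, ∀ a, ∃ m, f a (prefixWord q m) = some (F q a)

namespace ComputableOn

variable {S : Set Baire}

theorem of_computable {g : α → β} (hg : Computable g) : ComputableOn S fun _ a => g a :=
  ⟨fun a _ => some (g a), Computable.option_some.comp (hg.comp Computable.fst),
    fun _ _ _ _ _ h => h, fun _ _ _ => ⟨0, rfl⟩⟩

theorem oracle : ComputableOn S fun q n => q n := by
  refine ⟨fun n w => w[n]?, Computable.list_getElem?.comp Computable.snd Computable.fst,
    fun n w w' b h hb => ?_, fun q _ n => ⟨n + 1, by simp [prefixWord]⟩⟩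
  obtain ⟨v, rfl⟩ := h
  have hn : n < w.length := (List.getElem?_eq_some_iff.1 hb).1
  simpa only [List.getElem?_append_left hn] using hb

theorem comp {F : Baire → β → γ} {G : Baire → α → β} (hF : ComputableOn S F)
    (hG : ComputableOn S G) : ComputableOn S fun q a => F q (G q a) := by
  obtain ⟨f, hf, hfm, hfS⟩ := hF
  obtain ⟨g, hg, hgm, hgS⟩ := hG
  refine ⟨fun a w => (g a w).bind fun b => f b w, ?_, ?_, ?_⟩
  · exact Computable.option_bind (f := fun x : α × List ℕ => g x.1 x.2)
      (g := fun x b => f b x.2) hg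
      (hf.comp Computable.snd (Computable.snd.comp Computable.fst))
  · intro a w w' c h hc
    obtain ⟨b, hb, hc⟩ := Option.bind_eq_some_iff.1 hc
    exact Option.bind_eq_some_iff.2 ⟨b, hgm _ _ _ _ h hb, hfm _ _ _ _ h hc⟩
  · intro q hq a
    obtain ⟨m, hm⟩ := hgS q hq a
    obtain ⟨m', hm'⟩ := hfS q hq (G q a)
    exact ⟨max m m', Option.bind_eq_some_iff.2
      ⟨_, hgm _ _ _ _ (prefixWord_prefix q (le_max_left m m')) hm,
        hfm _ _ _ _ (prefixWord_prefix q (le_max_right m m')) hm'⟩⟩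

theorem prodMk {F : Baire → α → β} {G : Baire → α → γ} (hF : ComputableOn S F)
    (hG : ComputableOn S G) : ComputableOn S fun q a => (F q a, G q a) := by
  obtain ⟨f, hf, hfm, hfS⟩ := hF
  obtain ⟨g, hg, hgm, hgS⟩ := hG
  refine ⟨fun a w => (f a w).bind fun b => (g a w).map fun c => (b, c), ?_, ?_, ?_⟩
  · refine Computable.option_bind (f := fun x : α × List ℕ => f x.1 x.2)
      (g := fun x b => (g x.1 x.2).map fun c => (b, c)) hf ?_
    exact Computable.option_map (f := fun x : (α × List ℕ) × β => g x.1.1 x.1.2)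
      (g := fun x c => (x.2, c))
      (hg.comp (Computable.fst.comp Computable.fst) (Computable.snd.comp Computable.fst))
      ((Computable.snd.comp Computable.fst).pair Computable.snd)
  · intro a w w' c h hc
    obtain ⟨b, hb, hc⟩ := Option.bind_eq_some_iff.1 hc
    obtain ⟨d, hd, rfl⟩ := Option.map_eq_some_iff.1 hc
    simp [hfm _ _ _ _ h hb, hgm _ _ _ _ h hd]
  · intro q hq a
    obtain ⟨m, hm⟩ := hfS q hq a
    obtain ⟨m', hm'⟩ := hgS q hq a
    refine ⟨max m m', ?_⟩
    simp [hfm _ _ _ _ (prefixWord_prefix q (le_max_left m m')) hm,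
        hgm _ _ _ _ (prefixWord_prefix q (le_max_right m m')) hm']

/-- Precomposition with a computable function of the arguments. -/
theorem comp_computable {F : Baire → β → γ} {g : α → β} (hF : ComputableOn S F)
    (hg : Computable g) : ComputableOn S fun q a => F q (g a) :=
  hF.comp (of_computable hg)

/-- Postcomposition with a computable function of two values. -/
theorem map₂ {δ : Type} [Primcodable δ] {g : β → γ → δ} (hg : Computable₂ g)
    {F : Baire → α → β} {G : Baire → α → γ}
    (hF : ComputableOn S F) (hG : ComputableOn S G) :
    ComputableOn S fun q a => g (F q a) (G q a) :=
  (of_computable (S := S) hg).comp (hF.prodMk hG)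

theorem map {g : β → γ} (hg : Computable g) {F : Baire → α → β} (hF : ComputableOn S F) :
    ComputableOn S fun q a => g (F q a) :=
  (of_computable (S := S) hg).comp hF

theorem cond {P : Baire → α → Bool} {F G : Baire → α → β} (hP : ComputableOn S P)
    (hF : ComputableOn S F) (hG : ComputableOn S G) :
    ComputableOn S fun q a => bif P q a then F q a else G q a :=
  (of_computable (S := S) (g := fun x : Bool × β × β => bif x.1 then x.2.1 else x.2.2)
    (Computable.cond Computable.fst (Computable.fst.comp Computable.snd)
      (Computable.snd.comp Computable.snd))).comp (hP.prodMk (hF.prodMk hG))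

/-- On a finite prefix the recursion is run in the `Option` monad. Finitely many steps consult
finitely many prefixes, and by monotonicity the longest of them serves for all steps. -/
theorem natRec {F : Baire → α → β} {G : Baire → α × ℕ × β → β} (hF : ComputableOn S F)
    (hG : ComputableOn S G) :
    ComputableOn S fun q (x : α × ℕ) =>
      Nat.rec (motive := fun _ => β) (F q x.1) (fun n b => G q (x.1, n, b)) x.2 := by
  obtain ⟨f, hf, hfm, hfS⟩ := hF
  obtain ⟨g, hg, hgm, hgS⟩ := hG
  let φ : α → List ℕ → ℕ → Option β := fun a w k =>
    Nat.rec (motive := fun _ => Option β) (f a w) (fun n o => o.bind fun b => g (a, n, b) w) k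
  have hφ : ∀ a w w' k b, w <+: w' → φ a w k = some b → φ a w' k = some b := by
    intro a w w' k b h
    induction k generalizing b with
    | zero => exact hfm _ _ _ _ h
    | succ k ih =>
      intro hb
      obtain ⟨c, hc, hb⟩ := Option.bind_eq_some_iff.1 hb
      exact Option.bind_eq_some_iff.2 ⟨c, ih c hc, hgm _ _ _ _ h hb⟩
  refine ⟨fun x w => φ x.1 w x.2, ?_, fun x w w' b h => hφ _ _ _ _ _ h, ?_⟩
  · refine Computable.nat_rec (f := fun y : (α × ℕ) × List ℕ => y.1.2)
      (g := fun y => f y.1.1 y.2)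
      (h := fun y (p : ℕ × Option β) => p.2.bind fun b => g (y.1.1, p.1, b) y.2)
      (Computable.snd.comp Computable.fst)
      (hf.comp (Computable.fst.comp Computable.fst) Computable.snd) ?_
    refine Computable.option_bind
      (f := fun z : ((α × ℕ) × List ℕ) × ℕ × Option β => z.2.2)
      (g := fun z b => g (z.1.1.1, z.2.1, b) z.1.2) (Computable.snd.comp Computable.snd) ?_
    refine hg.comp (Computable.pair ?_ (Computable.pair ?_ Computable.snd)) ?_
    · exact Computable.fst.comp (Computable.fst.comp (Computable.fst.comp Computable.fst))
    · exact Computable.fst.comp (Computable.snd.comp Computable.fst)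
    · exact Computable.snd.comp (Computable.fst.comp Computable.fst)
  · rintro q hq ⟨a, k⟩
    induction k with
    | zero => exact hfS q hq a
    | succ k ih =>
      obtain ⟨m, hm⟩ := ih
      obtain ⟨m', hm'⟩ := hgS q hq (a, k,
        Nat.rec (motive := fun _ => β) (F q a) (fun n b => G q (a, n, b)) k)
      exact ⟨max m m', Option.bind_eq_some_iff.2
        ⟨_, hφ _ _ _ _ _ (prefixWord_prefix q (le_max_left m m')) hm,
          hgm _ _ _ _ (prefixWord_prefix q (le_max_right m m')) hm'⟩⟩

/-- Unbounded search, provided that it is successful for all oracles in `S`. -/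
theorem search {P : Baire → α × ℕ → Bool} (hP : ComputableOn S P)
    (hex : ∀ q ∈ S, ∀ a, ∃ n, P q (a, n) = true) :
    ComputableOn S fun q a => sInf {n | P q (a, n) = true} := by
  obtain ⟨p, hp, hpm, hpS⟩ := hP
  -- The outer `none` means that the prefix is too short, `some none` that nothing has been found
  -- yet, and `some (some n)` that n is the result, which is then kept.
  let step : α → List ℕ → ℕ → Option ℕ → Option (Option ℕ) := fun a w k o =>
    Option.casesOn o ((p (a, k) w).map fun b => bif b then some k else none)
      (fun n => some (some n))
  let σ : α → List ℕ → ℕ → Option (Option ℕ) := fun a w k =>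
    Nat.rec (motive := fun _ => Option (Option ℕ)) (some none)
      (fun k o => o.bind fun o => step a w k o) k
  have hσ : ∀ a w w' k o, w <+: w' → σ a w k = some o → σ a w' k = some o := by
    intro a w w' k o h
    induction k generalizing o with
    | zero => exact id
    | succ k ih =>
      intro ho
      obtain ⟨c, hc, ho⟩ := Option.bind_eq_some_iff.1 ho
      refine Option.bind_eq_some_iff.2 ⟨c, ih c hc, ?_⟩
      cases c with
      | some n => exact ho
      | none =>
        obtain ⟨b, hb, rfl⟩ := Option.map_eq_some_iff.1 ho
        exact Option.map_eq_some_iff.2 ⟨b, hpm _ _ _ _ h hb, rfl⟩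
  have hσk : ∀ a w k k' n, k ≤ k' → σ a w k = some (some n) → σ a w k' = some (some n) := by
    intro a w k k' n h h0
    induction k', h using Nat.le_induction with
    | base => exact h0
    | succ k' _ ih => exact Option.bind_eq_some_iff.2 ⟨_, ih, rfl⟩
  -- The length of the prefix also bounds the number of search steps, which makes the search total.
  refine ⟨fun a w => (σ a w w.length).bind id, ?_, ?_, ?_⟩
  · refine Computable.option_bind (f := fun y : α × List ℕ => σ y.1 y.2 y.2.length)
      (g := fun _ o => o) ?_ Computable.snd
    refine Computable.nat_rec (f := fun y : α × List ℕ => y.2.length)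
      (g := fun _ => some none)
      (h := fun y (z : ℕ × Option (Option ℕ)) => z.2.bind fun o => step y.1 y.2 z.1 o)
      (Computable.list_length.comp Computable.snd) (Computable.const _) ?_
    refine Computable.option_bind
      (f := fun z : (α × List ℕ) × ℕ × Option (Option ℕ) => z.2.2)
      (g := fun z o => step z.1.1 z.1.2 z.2.1 o) (Computable.snd.comp Computable.snd) ?_
    refine Computable.option_casesOn
      (o := fun z : ((α × List ℕ) × ℕ × Option (Option ℕ)) × Option ℕ => z.2)
      (f := fun z => (p (z.1.1.1, z.1.2.1) z.1.1.2).map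
        fun b => bif b then some z.1.2.1 else none)
      (g := fun _ n => some (some n)) Computable.snd ?_
      (Computable.option_some.comp (Computable.option_some.comp Computable.snd))
    refine Computable.option_map
      (f := fun z : ((α × List ℕ) × ℕ × Option (Option ℕ)) × Option ℕ =>
        p (z.1.1.1, z.1.2.1) z.1.1.2)
      (g := fun z b => bif b then some z.1.2.1 else none) ?_ ?_
    · refine hp.comp (Computable.pair ?_ ?_) ?_
      · exact Computable.fst.comp (Computable.fst.comp Computable.fst)
      · exact Computable.fst.comp (Computable.snd.comp Computable.fst)
      · exact Computable.snd.comp (Computable.fst.comp Computable.fst)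
    · exact Computable.cond Computable.snd
        (Computable.option_some.comp (Computable.fst.comp (Computable.snd.comp
          (Computable.fst.comp Computable.fst)))) (Computable.const _)
  · intro a w w' n h hn
    obtain ⟨o, ho, rfl⟩ := Option.bind_eq_some_iff.1 hn
    exact Option.bind_eq_some_iff.2
      ⟨_, hσk _ _ _ _ _ h.length_le (hσ _ _ _ _ _ h ho), rfl⟩
  · intro q hq a
    set N := sInf {n | P q (a, n) = true} with hN
    have hPN : P q (a, N) = true := Nat.sInf_mem (s := {n | P q (a, n) = true}) (hex q hq a)
    have hlt : ∀ k < N, P q (a, k) = false := fun k hk =>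
      Bool.eq_false_iff.2 (Nat.notMem_of_lt_sInf hk)
    have key : ∀ k ≤ N, ∃ m, σ a (prefixWord q m) k = some none := by
      intro k hk
      induction k with
      | zero => exact ⟨0, rfl⟩
      | succ k ih =>
        obtain ⟨m, hm⟩ := ih (by omega)
        obtain ⟨m', hm'⟩ := hpS q hq (a, k)
        refine ⟨max m m', Option.bind_eq_some_iff.2
          ⟨_, hσ _ _ _ _ _ (prefixWord_prefix q (le_max_left m m')) hm, ?_⟩⟩
        refine Option.map_eq_some_iff.2
          ⟨_, hpm _ _ _ _ (prefixWord_prefix q (le_max_right m m')) hm', ?_⟩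
        rw [hlt k (by omega)]
        rfl
    obtain ⟨m, hm⟩ := key N le_rfl
    obtain ⟨m', hm'⟩ := hpS q hq (a, N)
    -- The prefix must answer all tests up to N, and its length must allow for N + 1 search steps.
    let M := max (max m m') (N + 1)
    have h1 : σ a (prefixWord q M) (N + 1) = some (some N) := by
      refine Option.bind_eq_some_iff.2 ⟨_, hσ _ _ _ _ _ (prefixWord_prefix q
        ((le_max_left m m').trans (le_max_left _ _))) hm, ?_⟩
      refine Option.map_eq_some_iff.2 ⟨_, hpm _ _ _ _ (prefixWord_prefix q
        ((le_max_right m m').trans (le_max_left _ _))) hm', ?_⟩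
      rw [hPN]
      rfl
    refine ⟨M, Option.bind_eq_some_iff.2 ⟨some N, ?_, rfl⟩⟩
    refine hσk a _ (N + 1) _ _ ?_ h1
    rw [length_prefixWord]
    exact le_max_right _ _

/-- The word `F q (a, 0), …, F q (a, n - 1)`. -/
theorem prefixWord {F : Baire → α × ℕ → ℕ} (hF : ComputableOn S F) :
    ComputableOn S fun q (x : α × ℕ) => prefixWord (fun n => F q (x.1, n)) x.2 := by
  have h := natRec (S := S) (α := α) (F := fun _ _ => ([] : List ℕ))
    (G := fun q x => x.2.2 ++ [F q (x.1, x.2.1)]) (of_computable (Computable.const []))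
    (map₂ (g := fun (l : List ℕ) (n : ℕ) => l ++ [n])
      (Computable.list_append.comp Computable.fst
        (Computable.list_cons.comp Computable.snd (Computable.const [])))
      (of_computable (Computable.snd.comp Computable.snd))
      (hF.comp_computable
        (Computable.fst.pair (Computable.fst.comp Computable.snd))))
  convert h using 3 with q x
  generalize x.2 = k
  induction k with
  | zero => rfl
  | succ k ih =>
    rw [Weihrauch.prefixWord, List.range_succ, List.map_append]
    exact congrArg (· ++ [F q (x.1, k)]) ih

/-- The pairing of two uniformly computable sequences. -/
theorem pair {F G : Baire → ℕ → ℕ} (hF : ComputableOn S F) (hG : ComputableOn S G) :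
    ComputableOn S fun q => pair (F q) (G q) := by
  have hdiv : Computable fun n : ℕ => n / 2 :=
    (Primrec.nat_div.comp Primrec.id (Primrec.const 2)).to_comp
  have hmod : Computable fun n : ℕ => decide (n % 2 = 0) :=
    (PrimrecPred.decide (Primrec.eq.comp (Primrec.nat_mod.comp Primrec.id (Primrec.const 2))
      (Primrec.const 0))).to_comp
  have h := cond (of_computable hmod) (hF.comp_computable hdiv) (hG.comp_computable hdiv)
  convert h using 3 with q n
  by_cases hn : n % 2 = 0 <;> simp [Weihrauch.pair, hn]

/-- The name answers a query by running the finite-prefix function, with 0 for "prefix too short"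
and a shift by one otherwise. `Φ` uses the shortest prefix that is answered; monotonicity makes this
answer agree with the one on a prefix known to be correct. -/
theorem computableFun {F : Baire → Baire} (hF : ComputableOn S F) :
    ComputableFun fun q => ⟨q ∈ S, fun _ => F q⟩ := by
  obtain ⟨f, hf, hfm, hfS⟩ := hF
  let p : Baire := fun k => ((Encodable.decode (α := List ℕ) k.unpair.2).bind
    fun w => (f k.unpair.1 w).map Nat.succ).getD 0
  have hp : ∀ n w, p (query n w) = ((f n w).map Nat.succ).getD 0 := by
    intro n w
    simp [p, query]
  refine ⟨p, ?_, ?_⟩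
  · refine Computable.option_getD ?_ (Computable.const 0)
    refine Computable.option_bind (f := fun k : ℕ => Encodable.decode (α := List ℕ) k.unpair.2)
      (g := fun k w => (f k.unpair.1 w).map Nat.succ)
      (Computable.decode.comp (Computable.snd.comp Computable.unpair)) ?_
    exact Computable.option_map (f := fun x : ℕ × List ℕ => f x.1.unpair.1 x.2)
      (g := fun _ v => Nat.succ v)
      (hf.comp (Computable.fst.comp (Computable.unpair.comp Computable.fst)) Computable.snd)
      (Computable.succ.comp Computable.snd)
  · rintro q _ ⟨hq, rfl⟩
    have hex : ∀ n, ∃ m, p (query n (Weihrauch.prefixWord q m)) ≠ 0 := by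
      intro n
      obtain ⟨m, hm⟩ := hfS q hq n
      exact ⟨m, by simp [hp, hm]⟩
    refine ⟨hex, funext fun n => ?_⟩
    obtain ⟨m, hm⟩ := hfS q hq n
    have h := Nat.find_spec (hex n)
    change p (query n (Weihrauch.prefixWord q (Nat.find (hex n)))) - 1 = F q n
    rw [hp] at h ⊢
    generalize Nat.find (hex n) = k at h ⊢
    cases hv : f n (Weihrauch.prefixWord q k) with
    | none => simp [hv] at h
    | some v =>
      have h1 := hfm _ _ _ _ (prefixWord_prefix q (le_max_left m k)) hm
      have h2 := hfm _ _ _ _ (prefixWord_prefix q (le_max_right m k)) hv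
      simpa using Option.some.inj (h2.symm.trans h1)

end ComputableOn

theorem computable_query : Computable₂ query :=
  Primrec₂.natPair.to_comp.comp Computable.fst (Computable.encode.comp Computable.snd)

end

theorem computableFun_id : ComputableFun fun q => Part.some q := by
  obtain ⟨p, hp, h⟩ := (ComputableOn.oracle (S := Set.univ)).computableFun
  exact ⟨p, hp, fun q r hr => h q r ⟨trivial, (Part.mem_some_iff.1 hr).symm⟩⟩

theorem mem_Φ_iff {p q r : Baire} : r ∈ Φ p q ↔
    ∀ n, ∃ m, p (query n (prefixWord q m)) = r n + 1 ∧
      ∀ k < m, p (query n (prefixWord q k)) = 0 := by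
  constructor
  · rintro ⟨hex, rfl⟩ n
    refine ⟨Nat.find (hex n), (Nat.succ_pred (Nat.find_spec (hex n))).symm, fun k hk => ?_⟩
    simpa using Nat.find_min (hex n) hk
  · intro h
    have hex : ∀ n, ∃ m, p (query n (prefixWord q m)) ≠ 0 := fun n => by
      obtain ⟨m, hm, -⟩ := h n
      exact ⟨m, by omega⟩
    refine ⟨hex, funext fun n => ?_⟩
    change p (query n (prefixWord q (Nat.find (hex n)))) - 1 = r n
    obtain ⟨m, hm, hlt⟩ := h n
    have : Nat.find (hex n) = m :=
      (Nat.find_eq_iff (hex n)).2 ⟨by omega, fun k hk => by simp [hlt k hk]⟩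
    rw [this, hm, Nat.add_sub_cancel]

theorem prefixWord_succ (q : Baire) (m : ℕ) :
    prefixWord q (m + 1) = q 0 :: prefixWord (fun n => q (n + 1)) m := by
  simp [prefixWord, List.range_succ_eq_map, Function.comp_def]

/-! ### From two guesses to a function on {0, 1} and a subset of {0, 1} -/

/-- The closed sets of a discrete two-point space are all its subsets. -/
theorem isClosed_fin_two (B : Set (Fin 2)) : @IsClosed _ (finalTopology (Fin 2)) B := by
  rw [← @isOpen_compl_iff _ _ (finalTopology (Fin 2)), isOpen_coinduced]
  -- The represented point depends only on the first entry of the name, which is a continuous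
  -- function into a discrete space.
  have h : (fun p : {p : Baire // ∃ x : Fin 2, Represented.Names p x} => p.2.choose) ⁻¹' Bᶜ
      = (fun p : {p : Baire // ∃ x : Fin 2, Represented.Names p x} => p.1 0) ⁻¹'
        {n | ∃ i : Fin 2, n = i ∧ i ∉ B} := by
    ext p
    have hp : p.1 0 = p.2.choose := p.2.choose_spec
    constructor
    · intro h
      exact ⟨_, hp, h⟩
    · rintro ⟨i, hi, hiB⟩
      have : p.2.choose = i := Fin.ext (hp.symm.trans hi)
      change p.2.choose ∉ B
      rwa [this]
  rw [h]
  exact (isOpen_discrete _).preimage ((continuous_apply 0).comp continuous_subtype_val)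

/-- The part of the input of a `query` that has been read. -/
def queryWord (k : ℕ) : List ℕ := (Encodable.decode k.unpair.2).getD []

theorem queryWord_query (n : ℕ) (w : List ℕ) : queryWord (query n w) = w := by
  simp [queryWord, query]

theorem unpair_fst_query (n : ℕ) (w : List ℕ) : (query n w).unpair.1 = n := by
  simp [query]

theorem computable_queryWord : Computable queryWord :=
  Computable.option_getD
    (Computable.decode.comp (Computable.snd.comp Computable.unpair)) (Computable.const [])

/-- Given a name `⟨a, ⟨y₀, y₁⟩⟩`, this is a name of the function that maps `i` to `yᵢ`. -/
def selectName (q : Baire) : Baire := fun k =>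
  bif decide ((queryWord k).length = 0) then 0
    else q (4 * k.unpair.1 + 1 + 2 * (queryWord k).headI) + 1

/-- Given a name `⟨a, ⟨y₀, y₁⟩⟩`, this is a negative name of the set of all `i` such that the
point with the name `yᵢ` belongs to the set with the negative name `a`. -/
def memberName (q : Baire) : Baire := fun k =>
  bif decide ((queryWord k).length = 0) then 0
    else q (2 * query k.unpair.1
      (prefixWord (fun m => q (4 * m + 1 + 2 * (queryWord k).headI)) ((queryWord k).length - 1)))

/-- Output starts after one input symbol, the index c 0. The n-th symbol of yᵢ sits at position 2(2n
+ i) + 1 = 4n + 1 + 2i of ⟨a, ⟨y₀, y₁⟩⟩. -/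
theorem selectName_mem (q c : Baire) :
    (fun n => q (4 * n + 1 + 2 * c 0)) ∈ Φ (selectName q) c := by
  rw [mem_Φ_iff]
  intro n
  refine ⟨1, ?_, fun k hk => ?_⟩
  · simp [selectName, queryWord_query, unpair_fst_query, prefixWord_succ]
  · obtain rfl : k = 0 := by omega
    simp [selectName, queryWord_query, prefixWord]

/-- Reading m + 1 symbols of c simulates the name a on the first m symbols of the selected point.
The extra symbol guarantees that the index is known. -/
theorem memberName_mem {q c r : Baire}
    (h : r ∈ Φ (fun n => q (2 * n)) fun m => q (4 * m + 1 + 2 * c 0)) :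
    r ∈ Φ (memberName q) c := by
  rw [mem_Φ_iff] at h ⊢
  have h0 : ∀ n, memberName q (query n (prefixWord c 0)) = 0 := fun n => by
    simp [memberName, queryWord_query, prefixWord]
  have hs : ∀ n m, memberName q (query n (prefixWord c (m + 1))) =
      q (2 * query n (prefixWord (fun m => q (4 * m + 1 + 2 * c 0)) m)) := fun n m => by
    simp [memberName, queryWord_query, unpair_fst_query, length_prefixWord, prefixWord_succ]
  intro n
  obtain ⟨m, hm, hlt⟩ := h n
  refine ⟨m + 1, (hs n m).trans hm, fun k hk => ?_⟩
  cases k with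
  | zero => exact h0 n
  | succ k => exact (hs n k).trans (hlt k (by omega))

theorem computable_index : Computable₂ fun n i : ℕ => 4 * n + 1 + 2 * i :=
  (Primrec.nat_add.comp (Primrec.nat_add.comp
    (Primrec.nat_mul.comp (Primrec.const 4) Primrec.fst) (Primrec.const 1))
    (Primrec.nat_mul.comp (Primrec.const 2) Primrec.snd)).to_comp

theorem computable_queryWord_isEmpty : Computable fun k => decide ((queryWord k).length = 0) :=
  (PrimrecPred.decide (Primrec.eq.comp Primrec.id (Primrec.const 0))).to_comp.comp
    (Computable.list_length.comp computable_queryWord)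

theorem computable_queryWord_headI : Computable fun k => (queryWord k).headI :=
  Primrec.list_headI.to_comp.comp computable_queryWord

theorem computableOn_selectName (S : Set Baire) : ComputableOn S selectName :=
  ComputableOn.cond (ComputableOn.of_computable computable_queryWord_isEmpty)
    (ComputableOn.of_computable (Computable.const 0))
    (ComputableOn.map Computable.succ (ComputableOn.oracle.comp_computable
      (computable_index.comp (Computable.fst.comp Computable.unpair) computable_queryWord_headI)))

theorem computableOn_memberName (S : Set Baire) : ComputableOn S memberName := by
  refine ComputableOn.cond (ComputableOn.of_computable computable_queryWord_isEmpty)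
    (ComputableOn.of_computable (Computable.const 0)) (ComputableOn.oracle.comp ?_)
  refine ComputableOn.map (Primrec.nat_mul.comp (Primrec.const 2) Primrec.id).to_comp
    (ComputableOn.map₂ computable_query
      (ComputableOn.of_computable (Computable.fst.comp Computable.unpair)) ?_)
  have h : ComputableOn S fun q (x : ℕ × ℕ) => q (4 * x.2 + 1 + 2 * x.1) :=
    ComputableOn.oracle.comp_computable (computable_index.comp Computable.snd Computable.fst)
  exact h.prefixWord.comp_computable (computable_queryWord_headI.pair
    ((Primrec.nat_sub.comp Primrec.id (Primrec.const 1)).to_comp.comp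
      (Computable.list_length.comp computable_queryWord)))

/-- The implication from binary choice reduces to the version of a choice problem that
admits two guesses. -/
theorem implication_reducible_half (X : Type*) [Represented X]
    (h : (closedChoice (Fin 2)).dom.Nonempty ∨ (closedChoice X).dom = ∅) :
    Reducible (implication (closedChoice (Fin 2)) (closedChoice X) h) (halfClosedChoice X) := by
  refine ⟨_, _, ((computableOn_selectName Set.univ).pair
    (computableOn_memberName _)).computableFun, computableFun_id, fun G hG a A ha hA => ?_⟩
  have hAne : A.1.Nonempty := by
    obtain ⟨Hx, ⟨z, hz⟩, hsub⟩ := hA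
    exact ⟨z, hsub hz⟩
  obtain ⟨r, hr, ⟨x₀, x₁⟩, hx, y₀, y₁, rfl, hy₀, hy₁⟩ :=
    hG a A ha ⟨(hAne.some, hAne.some), Or.inl hAne.some_mem⟩
  set q := pair a (pair y₀ y₁) with hq
  let x : Fin 2 → X := ![x₀, x₁]
  let y : Fin 2 → Baire := ![y₀, y₁]
  have hxy : ∀ i, Represented.Names (y i) (x i) := fun i => by
    fin_cases i
    · exact hy₀
    · exact hy₁
  have hqa : (fun n => q (2 * n)) = a := funext fun n => pair_even _ _ _
  have hqy : ∀ i : Fin 2, (fun n => q (4 * n + 1 + 2 * (i : ℕ))) = y i := by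
    intro i
    funext n
    fin_cases i
    · have : 4 * n + 1 + 2 * 0 = 2 * (2 * n) + 1 := by omega
      change q (4 * n + 1 + 2 * 0) = y₀ n
      rw [this, hq, pair_odd, pair_even]
    · have : 4 * n + 1 + 2 * 1 = 2 * (2 * n + 1) + 1 := by omega
      change q (4 * n + 1 + 2 * 1) = y₁ n
      rw [this, hq, pair_odd, pair_odd]
  have hsel : ∀ (i : Fin 2) c d, Represented.Names c i → y i ∈ Φ (selectName q) (pair c d) := by
    intro i c d hc
    have h0 : pair c d 0 = i := (pair_even c d 0).trans hc
    have h1 := selectName_mem q (pair c d)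
    rwa [h0, hqy] at h1
  let B : ClosedSubset (Fin 2) := ⟨{i | x i ∈ A.1}, isClosed_fin_two _⟩
  have hB : Represented.Names (memberName q) B := by
    intro c i hc
    obtain ⟨s, hs, hsA⟩ := ha (y i) (x i) (hxy i)
    refine ⟨s, memberName_mem ?_, hsA⟩
    have h0 : c 0 = i := hc
    rwa [h0, hqy, hqa]
  have hstrong : ∀ i, strongFun (Fin 2) X (selectName q) i = {x i} := by
    intro i
    ext z
    constructor
    · rintro ⟨-, c, d, hc, s, hs, hz⟩
      obtain rfl := Part.mem_unique hs (hsel i c d hc)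
      exact Represented.functional hz (hxy i)
    -- The second component of a cylindrified name is ignored, so any sequence can be supplied for
    -- it.
    · rintro rfl
      exact ⟨fun c d hc => ⟨_, hsel i c d hc, _, hxy i⟩, fun _ => i, fun _ => i, rfl, _,
        hsel i _ _ rfl, hxy i⟩
  have hBne : B.1.Nonempty := by
    rcases hx with hx | hx
    · exact ⟨0, hx⟩
    · exact ⟨1, hx⟩
  refine ⟨pair (selectName q) (memberName q), ?_, (⟨_, _, rfl⟩, B), ⟨?_, ?_⟩, _, _, rfl, rfl, hB⟩
  · refine Part.mem_bind (Part.mem_some a) (Part.mem_bind hr ?_)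
    exact ⟨trivial, rfl⟩
  · refine ⟨x hBne.some, fun i _ => ?_, hBne.some, hBne.some_mem, ?_⟩
    · exact ⟨x i, (hstrong i).ge rfl⟩
    · exact (hstrong _).ge rfl
  · rintro z ⟨-, i, hi, hz⟩
    obtain rfl : z = x i := (hstrong i).le hz
    exact hi

/-! ### Turning arbitrary sequences of rational numbers into names -/

/-- The code of the point of `[0, 1]` next to a given rational number. -/
def clampCode (a : ℕ) : ℕ :=
  bif decide (a.unpair.1 ≤ a.unpair.2.unpair.1) then 0
  else bif decide (a.unpair.2.unpair.1 + (a.unpair.2.unpair.2 + 1) ≤ a.unpair.1)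
    then Nat.pair 1 0 else a

/-- The code 0 stands for the rational 0 and `Nat.pair 1 0` for 1; comparing with these only takes
comparisons of natural numbers. -/
theorem ratOfNat_clampCode (a : ℕ) : ratOfNat (clampCode a) = max 0 (min 1 (ratOfNat a)) := by
  have hc : (0 : ℚ) < (a.unpair.2.unpair.2 : ℚ) + 1 := by positivity
  by_cases h1 : a.unpair.1 ≤ a.unpair.2.unpair.1
  · have h1' : (a.unpair.1 : ℚ) ≤ a.unpair.2.unpair.1 := by exact_mod_cast h1
    have h : ratOfNat a ≤ 0 := div_nonpos_of_nonpos_of_nonneg (by linarith) hc.le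
    rw [max_eq_left ((min_le_right _ _).trans h)]
    simp [clampCode, h1, ratOfNat]
  · have h1' : (a.unpair.2.unpair.1 : ℚ) ≤ a.unpair.1 := by exact_mod_cast (not_le.1 h1).le
    have h : 0 ≤ ratOfNat a := div_nonneg (by linarith) hc.le
    by_cases h2 : a.unpair.2.unpair.1 + (a.unpair.2.unpair.2 + 1) ≤ a.unpair.1
    · have h2' : (a.unpair.2.unpair.1 : ℚ) + (a.unpair.2.unpair.2 + 1) ≤ a.unpair.1 := by
        exact_mod_cast h2
      have h3 : 1 ≤ ratOfNat a := (one_le_div hc).2 (by linarith)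
      rw [min_eq_left h3, max_eq_right zero_le_one]
      simp only [clampCode, decide_eq_false h1, decide_eq_true h2, cond_true, cond_false, ratOfNat,
        Nat.unpair_pair]
      norm_num [Nat.unpair_zero]
    · have h2' : (a.unpair.1 : ℚ) ≤ a.unpair.2.unpair.1 + (a.unpair.2.unpair.2 + 1) := by
        exact_mod_cast (not_le.1 h2).le
      have h3 : ratOfNat a ≤ 1 := (div_le_one hc).2 (by linarith)
      rw [min_eq_right h3, max_eq_right h]
      simp only [clampCode, decide_eq_false h1, decide_eq_false h2, cond_false]

/-- The rational numbers with the codes `a` and `b` have distance at most `2 * 2 ^ (-n)`. -/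
def closeCodes (n a b : ℕ) : Bool :=
  let x := a.unpair.1 * (b.unpair.2.unpair.2 + 1) + b.unpair.2.unpair.1 * (a.unpair.2.unpair.2 + 1)
  let y := a.unpair.2.unpair.1 * (b.unpair.2.unpair.2 + 1) + b.unpair.1 * (a.unpair.2.unpair.2 + 1)
  decide (((x - y) + (y - x)) * 2 ^ n ≤
    2 * ((a.unpair.2.unpair.2 + 1) * (b.unpair.2.unpair.2 + 1)))

/-- Cross-multiplying and moving the subtracted terms to the other side leaves two natural numbers x
and y, and with truncated subtraction (x - y) + (y - x) is |x - y|. -/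
theorem closeCodes_iff (n a b : ℕ) :
    closeCodes n a b = true ↔ |ratOfNat a - ratOfNat b| ≤ 2 / 2 ^ n := by
  unfold closeCodes ratOfNat
  generalize a.unpair.1 = a₁
  generalize a.unpair.2.unpair.1 = a₂
  generalize a.unpair.2.unpair.2 = a₃
  generalize b.unpair.1 = b₁
  generalize b.unpair.2.unpair.1 = b₂
  generalize b.unpair.2.unpair.2 = b₃
  have ha : (0 : ℚ) < (a₃ : ℚ) + 1 := by positivity
  have hb : (0 : ℚ) < (b₃ : ℚ) + 1 := by positivity
  have habs : ∀ x y : ℕ, (((x - y) + (y - x) : ℕ) : ℚ) = |(x : ℚ) - y| := by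
    intro x y
    rcases le_total x y with h | h
    · rw [Nat.sub_eq_zero_of_le h, abs_of_nonpos (by simpa using h), zero_add, Nat.cast_sub h]
      ring
    · rw [Nat.sub_eq_zero_of_le h, abs_of_nonneg (by simpa using h), add_zero, Nat.cast_sub h]
  rw [div_sub_div _ _ ha.ne' hb.ne', abs_div, abs_of_pos (mul_pos ha hb),
    div_le_div_iff₀ (mul_pos ha hb) (by positivity), decide_eq_true_iff, ← Nat.cast_le (α := ℚ),
    Nat.cast_mul, habs]
  push_cast
  ring_nf

/-- Clamp all members of a sequence to `[0, 1]`, and skip those with a large distance to the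
previous one. -/
def repairAux (d : Baire) (n : ℕ) : ℕ :=
  Nat.rec (motive := fun _ => ℕ) (clampCode (d 0))
    (fun n v => bif closeCodes n (clampCode (d (n + 1))) v then clampCode (d (n + 1)) else v) n

/-- A name of a point of `[0, 1]` that is obtained from an arbitrary sequence, and that is a name
of `x` if the sequence is a name of `x`. -/
def repair (d : Baire) : Baire := fun n => repairAux d (n + 2)

theorem repairAux_succ (d : Baire) (n : ℕ) : repairAux d (n + 1) =
    bif closeCodes n (clampCode (d (n + 1))) (repairAux d n) then clampCode (d (n + 1))
      else repairAux d n := rfl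

theorem dist_repairAux_succ (d : Baire) (n : ℕ) :
    dist (ratOfNat (repairAux d n) : ℝ) (ratOfNat (repairAux d (n + 1)) : ℝ) ≤ 4 / 2 / 2 ^ n := by
  rw [repairAux_succ]
  cases h : closeCodes n (clampCode (d (n + 1))) (repairAux d n) with
  | false =>
    rw [cond_false, dist_self]
    positivity
  | true =>
    rw [closeCodes_iff, abs_sub_comm] at h
    rw [cond_true, Real.dist_eq]
    have h' : ((|ratOfNat (repairAux d n) - ratOfNat (clampCode (d (n + 1)))| : ℚ) : ℝ)
      ≤ ((2 / 2 ^ n : ℚ) : ℝ) := Rat.cast_le.2 h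
    push_cast at h'
    norm_num
    exact h'

theorem repairAux_mem (d : Baire) (n : ℕ) :
    (ratOfNat (repairAux d n) : ℝ) ∈ Set.Icc (0 : ℝ) 1 := by
  have hc : ∀ a, (ratOfNat (clampCode a) : ℝ) ∈ Set.Icc (0 : ℝ) 1 := by
    intro a
    rw [ratOfNat_clampCode]
    constructor
    · exact_mod_cast le_max_left (0 : ℚ) _
    · exact_mod_cast max_le (zero_le_one' ℚ) (min_le_left _ _)
  induction n with
  | zero => exact hc _
  | succ n ih =>
    rw [repairAux_succ]
    cases closeCodes n (clampCode (d (n + 1))) (repairAux d n)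
    · exact ih
    · exact hc _

theorem repair_names_of_tendsto {d : Baire} {x : unitInterval}
    (h : Filter.Tendsto (fun n => (ratOfNat (repairAux d n) : ℝ)) Filter.atTop (nhds (x : ℝ))) :
    Represented.Names (repair d) x := by
  intro i
  -- Steps of size at most 2 / 2 ^ n leave an error of at most 4 / 2 ^ n; the shift by two in
  -- `repair` absorbs the factor 4.
  have h1 := dist_le_of_le_geometric_two_of_tendsto (dist_repairAux_succ d) h (i + 2)
  rw [Real.dist_eq] at h1
  refine h1.trans_eq ?_
  rw [pow_add, one_div, inv_pow]
  field_simp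
  norm_num

theorem exists_repair_names (d : Baire) : ∃ x : unitInterval, Represented.Names (repair d) x := by
  obtain ⟨x, hx⟩ := cauchySeq_tendsto_of_complete
    (cauchySeq_of_le_geometric_two (dist_repairAux_succ d))
  exact ⟨⟨x, isClosed_Icc.mem_of_tendsto hx (Filter.Eventually.of_forall (repairAux_mem d))⟩,
    repair_names_of_tendsto hx⟩

theorem repair_names {d : Baire} {x : unitInterval} (h : Represented.Names d x) :
    Represented.Names (repair d) x := by
  have hd : ∀ n, |(ratOfNat (clampCode (d n)) : ℝ) - x| ≤ (1 / 2 : ℝ) ^ n := by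
    intro n
    refine le_trans ?_ (h n)
    rw [ratOfNat_clampCode]
    push_cast
    have hx : (x : ℝ) = max 0 (min 1 (x : ℝ)) := by
      rw [min_eq_right x.2.2, max_eq_right x.2.1]
    conv_lhs => rw [hx]
    refine (abs_max_sub_max_le_max _ _ _ _).trans ?_
    rw [sub_self, abs_zero, max_eq_right (abs_nonneg _)]
    refine (abs_min_sub_min_le_max _ _ _ _).trans ?_
    rw [sub_self, abs_zero, max_eq_right (abs_nonneg _)]
  have ht : ∀ n, repairAux d n = clampCode (d n) := by
    intro n
    induction n with
    | zero => rfl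
    | succ n ih =>
      rw [repairAux_succ, ih]
      -- Successive entries of a name differ by at most 2 ^ (-n) + 2 ^ (-(n + 1)), and clamping does
      -- not increase the distance to x. So no entry is skipped.
      have hc : closeCodes n (clampCode (d (n + 1))) (clampCode (d n)) = true := by
        rw [closeCodes_iff, ← Rat.cast_le (K := ℝ)]
        push_cast
        have h1 := hd n
        have h2 := hd (n + 1)
        have h3 := abs_sub_le (ratOfNat (clampCode (d (n + 1))) : ℝ) x (ratOfNat (clampCode (d n)))
        rw [abs_sub_comm (x : ℝ)] at h3
        have h4 : (1 / 2 : ℝ) ^ (n + 1) ≤ (1 / 2 : ℝ) ^ n :=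
          pow_le_pow_of_le_one (by norm_num) (by norm_num) (Nat.le_succ n)
        have h5 : (2 : ℝ) / 2 ^ n = 2 * (1 / 2 : ℝ) ^ n := by
          rw [one_div, inv_pow, div_eq_mul_inv]
        linarith
      rw [hc, cond_true]
  refine repair_names_of_tendsto ?_
  simp only [ht]
  rw [tendsto_iff_dist_tendsto_zero]
  exact squeeze_zero (fun _ => dist_nonneg) (fun n => by rw [Real.dist_eq]; exact hd n)
    (tendsto_pow_atTop_nhds_zero_of_lt_one (by norm_num) (by norm_num))

theorem primrec_unpair_fst : Primrec fun a : ℕ => a.unpair.1 := Primrec.fst.comp Primrec.unpair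

theorem primrec_unpair_snd : Primrec fun a : ℕ => a.unpair.2 := Primrec.snd.comp Primrec.unpair

theorem computable_clampCode : Computable clampCode := by
  have h₁ := primrec_unpair_fst
  have h₂ := primrec_unpair_fst.comp primrec_unpair_snd
  have h₃ := primrec_unpair_snd.comp primrec_unpair_snd
  refine (Primrec.cond (PrimrecPred.decide (Primrec.nat_le.comp h₁ h₂)) (Primrec.const 0)
    (Primrec.cond (PrimrecPred.decide (Primrec.nat_le.comp
      (Primrec.nat_add.comp h₂ (Primrec.succ.comp h₃)) h₁)) (Primrec.const _) Primrec.id)).to_comp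

theorem primrec_two_pow : Primrec fun n : ℕ => 2 ^ n := by
  refine (Primrec.nat_rec₁ (f := fun _ v => 2 * v) 1
    (Primrec.nat_mul.comp (Primrec.const 2) Primrec.snd)).of_eq fun n => ?_
  induction n with
  | zero => rfl
  | succ n ih => exact (congrArg (2 * ·) ih).trans (pow_succ' 2 n).symm

theorem computable_closeCodes : Computable fun z : ℕ × ℕ × ℕ => closeCodes z.1 z.2.1 z.2.2 := by
  have ha : Primrec fun z : ℕ × ℕ × ℕ => z.2.1 := Primrec.fst.comp Primrec.snd
  have hb : Primrec fun z : ℕ × ℕ × ℕ => z.2.2 := Primrec.snd.comp Primrec.snd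
  have ha₁ := primrec_unpair_fst.comp ha
  have ha₂ := primrec_unpair_fst.comp (primrec_unpair_snd.comp ha)
  have ha₃ := Primrec.succ.comp (primrec_unpair_snd.comp (primrec_unpair_snd.comp ha))
  have hb₁ := primrec_unpair_fst.comp hb
  have hb₂ := primrec_unpair_fst.comp (primrec_unpair_snd.comp hb)
  have hb₃ := Primrec.succ.comp (primrec_unpair_snd.comp (primrec_unpair_snd.comp hb))
  have hx := Primrec.nat_add.comp (Primrec.nat_mul.comp ha₁ hb₃) (Primrec.nat_mul.comp hb₂ ha₃)
  have hy := Primrec.nat_add.comp (Primrec.nat_mul.comp ha₂ hb₃) (Primrec.nat_mul.comp hb₁ ha₃)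
  exact (PrimrecPred.decide (Primrec.nat_le.comp
    (Primrec.nat_mul.comp
      (Primrec.nat_add.comp (Primrec.nat_sub.comp hx hy) (Primrec.nat_sub.comp hy hx))
      (primrec_two_pow.comp Primrec.fst))
    (Primrec.nat_mul.comp (Primrec.const 2) (Primrec.nat_mul.comp ha₃ hb₃)))).to_comp

theorem ComputableOn.repair {S : Set Baire} {F : Baire → ℕ → ℕ} (hF : ComputableOn S F) :
    ComputableOn S fun q => repair (F q) := by
  have hc : ComputableOn S fun q n => clampCode (F q n) := hF.map computable_clampCode
  have h₀ : ComputableOn S fun q (_ : Unit) => clampCode (F q 0) :=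
    hc.comp_computable (Computable.const 0)
  have h₁ : ComputableOn S fun q (x : Unit × ℕ × ℕ) => clampCode (F q (x.2.1 + 1)) :=
    hc.comp_computable (Computable.succ.comp (Computable.fst.comp Computable.snd))
  have h₂ : ComputableOn S fun _ (x : Unit × ℕ × ℕ) => x.2.2 :=
    of_computable (Computable.snd.comp Computable.snd)
  have h₃ : ComputableOn S fun _ (x : Unit × ℕ × ℕ) => x.2.1 :=
    of_computable (Computable.fst.comp Computable.snd)
  have h₄ := h₀.natRec (cond ((h₃.prodMk (h₁.prodMk h₂)).map computable_closeCodes) h₁ h₂)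
  exact h₄.comp_computable ((Computable.const ()).pair
    (Computable.succ.comp Computable.succ))

/-! ### Running a strongly continuous function until an input is excluded -/

/-- A name of the point `i` of the two-point space. -/
def pointName (i : Fin 2) : Baire := fun n => bif decide (n = 0) then (i : ℕ) else 0

/-- The same sequence thus serves as a name of i for testing B and as a cylindrified name of i for
evaluating H. -/
theorem pair_pointName (i : Fin 2) : pair (pointName i) 0 = pointName i := by
  funext n
  rcases Nat.even_or_odd' n with ⟨k, rfl | rfl⟩
  · rw [pair_even]
    simp [pointName]
  · rw [pair_odd]
    simp [pointName]

theorem names_pointName (i : Fin 2) : Represented.Names (pointName i) i := rfl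

/-- The first nonzero entry of the name `b` at the queries for the `n`-th output symbol for which at
most `k` symbols of the name of `i` are read. -/
def firstAnswer (b : Baire) (i : Fin 2) (n k : ℕ) : ℕ :=
  Nat.rec (motive := fun _ => ℕ) (b (query n (prefixWord (pointName i) 0)))
    (fun k v => bif decide (v = 0) then b (query n (prefixWord (pointName i) (k + 1))) else v) k

theorem firstAnswer_succ (b : Baire) (i : Fin 2) (n k : ℕ) : firstAnswer b i n (k + 1) =
    bif decide (firstAnswer b i n k = 0) then b (query n (prefixWord (pointName i) (k + 1)))
      else firstAnswer b i n k := rfl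

theorem firstAnswer_eq_zero {b : Baire} {i : Fin 2} {n k : ℕ}
    (h : ∀ m ≤ k, b (query n (prefixWord (pointName i) m)) = 0) : firstAnswer b i n k = 0 := by
  induction k with
  | zero => exact h 0 le_rfl
  | succ k ih => simp [firstAnswer_succ, ih fun m hm => h m (by omega), h (k + 1) le_rfl]

/-- Only the first nonzero entry matters to `Φ`; entries at longer prefixes are unconstrained and
must not influence the test. -/
theorem firstAnswer_eq {b : Baire} {i : Fin 2} {n m v : ℕ}
    (hm : b (query n (prefixWord (pointName i) m)) = v + 1)
    (hlt : ∀ k < m, b (query n (prefixWord (pointName i) k)) = 0) (k : ℕ) :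
    firstAnswer b i n (m + k) = v + 1 := by
  induction k with
  | zero =>
    cases m with
    | zero => exact hm
    | succ m =>
      rw [add_zero, firstAnswer_succ, firstAnswer_eq_zero fun k hk => hlt k (by omega)]
      exact hm
  | succ k ih =>
    rw [← add_assoc, firstAnswer_succ, ih]
    rfl

/-- The `t`-th test whether the negative name `b` excludes `i`. -/
def excludes (b : Baire) (i : Fin 2) (t : ℕ) : Bool :=
  decide (2 ≤ firstAnswer b i t.unpair.1 t.unpair.2)

/-- For a member of B the output is the zero sequence. Output v is coded as v + 1, so the first
answer is 0 or 1 and never reaches the threshold 2. -/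
theorem excludes_eq_false {b : Baire} {B : Set (Fin 2)} (hb : NegativeName b B) {i : Fin 2}
    (hi : i ∈ B) (t : ℕ) : excludes b i t = false := by
  obtain ⟨r, hr, h⟩ := hb _ i (names_pointName i)
  obtain rfl := h.2 hi
  obtain ⟨m, hm, hlt⟩ := mem_Φ_iff.1 hr t.unpair.1
  have hle : firstAnswer b i t.unpair.1 t.unpair.2 ≤ 1 := by
    rcases lt_or_ge t.unpair.2 m with hk | hk
    · rw [firstAnswer_eq_zero fun k hk' => hlt k (by omega)]
      omega
    · obtain ⟨k, hk⟩ := Nat.exists_eq_add_of_le hk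
      rw [hk, firstAnswer_eq hm hlt]
      rfl
  exact decide_eq_false (by omega)

theorem exists_excludes {b : Baire} {B : Set (Fin 2)} (hb : NegativeName b B) {i : Fin 2}
    (hi : i ∉ B) : ∃ t, excludes b i t = true := by
  obtain ⟨r, hr, h⟩ := hb _ i (names_pointName i)
  obtain ⟨n, hn⟩ := Function.ne_iff.1 (fun h0 => hi (h.1 h0) : r ≠ 0)
  obtain ⟨m, hm, hlt⟩ := mem_Φ_iff.1 hr n
  have hn' : r n ≠ 0 := hn
  refine ⟨Nat.pair n m, decide_eq_true ?_⟩
  have := firstAnswer_eq hm hlt 0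
  rw [add_zero] at this
  rw [Nat.unpair_pair, this]
  omega

/-- Stage `t` of the computation of the `j`-th symbol of the value at `i` of the function with the
name `h` is successful: the symbol is known, or `i` is excluded. -/
def stage (h b : Baire) (i : Fin 2) (j t : ℕ) : Bool :=
  !decide (h (query j (prefixWord (pointName i) t)) = 0) || excludes b i t

/-- The `j`-th symbol of the value at `i` of the function with the name `h`. -/
noncomputable def symbol (h b : Baire) (i : Fin 2) (j : ℕ) : ℕ :=
  h (query j (prefixWord (pointName i) (sInf {t | stage h b i j t = true}))) - 1

theorem exists_stage {h b r : Baire} {B : Set (Fin 2)} (hb : NegativeName b B) {i : Fin 2}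
    (hr : i ∈ B → r ∈ Φ h (pointName i)) (j : ℕ) : ∃ t, stage h b i j t = true := by
  by_cases hi : i ∈ B
  · obtain ⟨t, ht, -⟩ := mem_Φ_iff.1 (hr hi) j
    exact ⟨t, by simp [stage, ht]⟩
  · obtain ⟨t, ht⟩ := exists_excludes hb hi
    exact ⟨t, by simp [stage, ht]⟩

/-- Members of B are never excluded, so the search stops exactly at the shortest prefix answered by
h, which is the one that `Φ` uses. -/
theorem symbol_eq {h b r : Baire} {B : Set (Fin 2)} (hb : NegativeName b B) {i : Fin 2}
    (hi : i ∈ B) (hr : r ∈ Φ h (pointName i)) : symbol h b i = r := by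
  funext j
  obtain ⟨t, ht, hlt⟩ := mem_Φ_iff.1 hr j
  have hs : ∀ k, stage h b i j k = true ↔ h (query j (prefixWord (pointName i) k)) ≠ 0 := by
    intro k
    simp [stage, excludes_eq_false hb hi]
  have : sInf {t | stage h b i j t = true} = t := by
    refine IsLeast.csInf_eq ⟨(hs t).2 (by omega), fun k hk => ?_⟩
    by_contra hkt
    exact (hs k).1 hk (hlt k (by omega))
  rw [symbol, this, ht, Nat.add_sub_cancel]

theorem computable_prefixWord_pointName (i : Fin 2) :
    Computable fun k => prefixWord (pointName i) k :=
  (Primrec.list_map Primrec.list_range (g := fun _ n => pointName i n)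
    (Primrec.cond (PrimrecPred.decide (Primrec.eq.comp Primrec.snd (Primrec.const 0)))
      (Primrec.const (i : ℕ)) (Primrec.const 0))).to_comp

/-- The component `h` of `⟨a, ⟨h, b⟩⟩`. -/
def fnPart (q : Baire) : Baire := fun k => q (4 * k + 1)

/-- The component `b` of `⟨a, ⟨h, b⟩⟩`. -/
def setPart (q : Baire) : Baire := fun k => q (4 * k + 3)

theorem fnPart_pair (a h b : Baire) : fnPart (pair a (pair h b)) = h := by
  funext k
  have : 4 * k + 1 = 2 * (2 * k) + 1 := by omega
  rw [fnPart, this, pair_odd, pair_even]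

theorem setPart_pair (a h b : Baire) : setPart (pair a (pair h b)) = b := by
  funext k
  have : 4 * k + 3 = 2 * (2 * k + 1) + 1 := by omega
  rw [setPart, this, pair_odd, pair_odd]

theorem computableOn_fnPart (S : Set Baire) : ComputableOn S fnPart := by
  have h : Primrec fun k : ℕ => 4 * k + 1 := Primrec.nat_add.comp
    (Primrec.nat_mul.comp (Primrec.const 4) Primrec.id) (Primrec.const 1)
  exact ComputableOn.oracle.comp_computable h.to_comp

theorem computableOn_setPart (S : Set Baire) : ComputableOn S setPart := by
  have h : Primrec fun k : ℕ => 4 * k + 3 := Primrec.nat_add.comp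
    (Primrec.nat_mul.comp (Primrec.const 4) Primrec.id) (Primrec.const 3)
  exact ComputableOn.oracle.comp_computable h.to_comp

theorem computable_eq_zero : Computable fun v : ℕ => decide (v = 0) :=
  (PrimrecPred.decide (Primrec.eq.comp Primrec.id (Primrec.const 0))).to_comp

theorem computable_query_pointName (i : Fin 2) :
    Computable₂ fun n k => query n (prefixWord (pointName i) k) :=
  computable_query.comp Computable.fst
    ((computable_prefixWord_pointName i).comp Computable.snd)

theorem computableOn_firstAnswer (S : Set Baire) (i : Fin 2) : ComputableOn S
    fun q (x : ℕ × ℕ) => firstAnswer (setPart q) i x.1 x.2 := by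
  have h₀ : ComputableOn S fun q n => setPart q (query n (prefixWord (pointName i) 0)) :=
    (computableOn_setPart S).comp_computable
      ((computable_query_pointName i).comp Computable.id (Computable.const 0))
  have h₁ : ComputableOn S fun q (x : ℕ × ℕ × ℕ) =>
      setPart q (query x.1 (prefixWord (pointName i) (x.2.1 + 1))) :=
    (computableOn_setPart S).comp_computable ((computable_query_pointName i).comp
      Computable.fst (Computable.succ.comp (Computable.fst.comp Computable.snd)))
  have h₂ : ComputableOn S fun _ (x : ℕ × ℕ × ℕ) => x.2.2 :=
    ComputableOn.of_computable (Computable.snd.comp Computable.snd)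
  exact h₀.natRec ((h₂.map computable_eq_zero).cond h₁ h₂)

theorem computableOn_stage (S : Set Baire) (i : Fin 2) : ComputableOn S
    fun q (x : ℕ × ℕ) => stage (fnPart q) (setPart q) i x.1 x.2 := by
  have h₁ : ComputableOn S fun q (x : ℕ × ℕ) =>
      fnPart q (query x.1 (prefixWord (pointName i) x.2)) :=
    (computableOn_fnPart S).comp_computable (computable_query_pointName i)
  have h₂ : ComputableOn S fun q (x : ℕ × ℕ) => excludes (setPart q) i x.2 :=
    ComputableOn.map (g := fun v => decide (2 ≤ v))
      (PrimrecPred.decide (Primrec.nat_le.comp (Primrec.const 2) Primrec.id)).to_comp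
      ((computableOn_firstAnswer S i).comp_computable
        (Computable.unpair.comp Computable.snd))
  exact ComputableOn.map₂ Primrec.or.to_comp ((h₁.map computable_eq_zero).map Primrec.not.to_comp)
    h₂

/-- The inputs for which all symbols are found. -/
def searchDomain : Set Baire := {q | ∀ i j, ∃ t, stage (fnPart q) (setPart q) i j t = true}

theorem computableOn_symbol (i : Fin 2) : ComputableOn searchDomain
    fun q j => symbol (fnPart q) (setPart q) i j := by
  have h := (computableOn_stage searchDomain i).search fun q hq j => hq i j
  exact ((computableOn_fnPart _).comp (ComputableOn.map₂ (computable_query_pointName i)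
    (ComputableOn.of_computable Computable.id) h)).map Primrec.pred.to_comp

/-- The two points computed from `⟨a, ⟨h, b⟩⟩`. -/
noncomputable def guess (q : Baire) (i : Fin 2) : Baire :=
  repair fun n => symbol (fnPart q) (setPart q) i n

theorem computableOn_guess (i : Fin 2) : ComputableOn searchDomain fun q => guess q i :=
  (computableOn_symbol i).repair

/-! ### From the implication to two guesses -/

/-- Constant functions are strongly continuous. -/
theorem exists_strongFun_eq (X : Type*) {Y : Type*} [Represented X] [Represented Y] (y : Y) :
    ∃ p, strongFun X Y p = fun _ => {y} := by
  obtain ⟨s, hs⟩ := Represented.surjective y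
  have hΦ : ∀ q, s ∈ Φ (fun k => s k.unpair.1 + 1) q := fun q =>
    mem_Φ_iff.2 fun n => ⟨0, by simp [query], by simp⟩
  refine ⟨fun k => s k.unpair.1 + 1, funext fun x => Set.ext fun z => ⟨?_, ?_⟩⟩
  · rintro ⟨-, q, r, -, t, ht, hz⟩
    obtain rfl := Part.mem_unique ht (hΦ _)
    exact Represented.functional hz hs
  · rintro rfl
    obtain ⟨q, hq⟩ := Represented.surjective x
    exact ⟨fun q r _ => ⟨s, hΦ _, _, hs⟩, q, q, hq, s, hΦ _, hs⟩

/-- Guessing two points of the unit interval, one of which is correct, reduces to the implication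
from binary choice. -/
theorem half_reducible_implication
    (h : (closedChoice (Fin 2)).dom.Nonempty ∨ (closedChoice unitInterval).dom = ∅) :
    Reducible (halfClosedChoice unitInterval)
      (implication (closedChoice (Fin 2)) (closedChoice unitInterval) h) := by
  refine ⟨_, _, ((computableOn_guess 0).pair (computableOn_guess 1)).computableFun,
    computableFun_id, fun G hG a A ha hA => ?_⟩
  have hAne : A.1.Nonempty := by
    obtain ⟨z, hz | hz⟩ := hA
    · exact ⟨_, hz⟩
    · exact ⟨_, hz⟩
  -- The oracle is only bound to answer on its domain. A constant function with value in A, paired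
  -- with the full set {0, 1}, is an admissible answer.
  have hdom : A ∈ (implication (closedChoice (Fin 2)) (closedChoice unitInterval) h).dom := by
    obtain ⟨x, hx⟩ := hAne
    obtain ⟨p, hp⟩ := exists_strongFun_eq (Fin 2) x
    refine ⟨(⟨fun _ => {x}, p, hp.symm⟩, ⟨Set.univ, isClosed_fin_two _⟩), ⟨x, ?_, 0, trivial, rfl⟩,
      ?_⟩
    · exact fun _ _ => ⟨x, rfl⟩
    · rintro z ⟨_, _, _, hz⟩
      exact (Set.mem_singleton_iff.1 hz).symm ▸ hx
  obtain ⟨s, hs, ⟨H, B⟩, ⟨⟨z, hBdom, i, hi, hz⟩, hsub⟩, f, b, rfl, hf, hb⟩ :=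
    hG a A ha hdom
  have hf' : H.1 = strongFun (Fin 2) unitInterval f := hf
  have hb' : NegativeName b B.1 := hb
  -- On B the function H is defined, so strong continuity makes f succeed on every name of k. The
  -- point named by the output is a value of H at a member of B and hence lies in A.
  have hval : ∀ k ∈ B.1, ∃ r ∈ Φ f (pointName k), ∃ x ∈ A.1, Represented.Names r x := by
    intro k hk
    obtain ⟨w, hw⟩ := hBdom hk
    obtain ⟨hw, -⟩ := hf'.le k hw
    obtain ⟨r, hr, x, hx⟩ := hw (pointName k) 0 (names_pointName k)
    refine ⟨r, pair_pointName k ▸ hr, x, hsub ⟨hBdom, k, hk, hf'.ge k ?_⟩, hx⟩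
    exact ⟨hw, _, _, names_pointName k, r, hr, hx⟩
  set q := pair a (pair f b) with hq
  have hqf : fnPart q = f := fnPart_pair a f b
  have hqb : setPart q = b := setPart_pair a f b
  have hqS : q ∈ searchDomain := by
    intro k j
    rw [hqf, hqb]
    by_cases hk : k ∈ B.1
    · obtain ⟨r, hr, -⟩ := hval k hk
      exact exists_stage hb' (fun _ => hr) j
    · exact exists_stage (r := 0) hb' (fun hk' => absurd hk' hk) j
  have hmem : ∀ k ∈ B.1, ∃ x ∈ A.1, Represented.Names (guess q k) x := by
    intro k hk
    obtain ⟨r, hr, x, hxA, hx⟩ := hval k hk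
    refine ⟨x, hxA, repair_names ?_⟩
    have : symbol (fnPart q) (setPart q) k = r := by
      rw [hqf, hqb]
      exact symbol_eq hb' hk hr
    exact this.symm ▸ hx
  -- Both components must be names, even the one whose index may lie outside B; this is what the
  -- repair is for.
  obtain ⟨x₀, h₀⟩ := exists_repair_names (symbol (fnPart q) (setPart q) 0)
  obtain ⟨x₁, h₁⟩ := exists_repair_names (symbol (fnPart q) (setPart q) 1)
  refine ⟨pair (guess q 0) (guess q 1), ?_, (x₀, x₁), ?_, _, _, rfl, h₀, h₁⟩
  · refine Part.mem_bind (Part.mem_some a) (Part.mem_bind hs ?_)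
    exact ⟨hqS, rfl⟩
  · obtain ⟨x, hxA, hx⟩ := hmem i hi
    have hi2 : i = 0 ∨ i = 1 := by omega
    rcases hi2 with rfl | rfl
    · exact Or.inl (Represented.functional hx h₀ ▸ hxA)
    · exact Or.inr (Represented.functional hx h₁ ▸ hxA)

end Weihrauch

theorem proposition53 :
    Weihrauch.Equivalent (Weihrauch.halfClosedChoice unitInterval)
      (Weihrauch.implication (Weihrauch.closedChoice (Fin 2)) (Weihrauch.closedChoice unitInterval)
        (Or.inl (Weihrauch.closedChoice_dom_nonempty (Fin 2)))) :=
  ⟨Weihrauch.half_reducible_implication _, Weihrauch.implication_reducible_half _ _⟩
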